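/- Let $L,T$ be finite sets with $|L|=|T|$ and let $C=(c_{\ell t})\in\mathbb{R}^{L\times T}$ be a cost matrix of an assignment problem. Consider the complete bipartite network with node set $N=L\,\dot\cup\,T$, arcs $(\ell,t)$ for $\ell\in L$, $t\in T$, supplies $b_\ell=1$ for $\ell\in L$, demands $b_t=-1$ for $t\in T$, and arc capacities $1$. Let $P$ be its pseudoflow polyhedron, i.e. the set of all $(x,s^+,s^-)\in\mathbb{R}^{L\times T}\times\mathbb{R}^N\times\mathbb{R}^N$ with $A_Gx-s^++s^-=b$, $0\le x\le 1$, $s^+\ge 0$, $s^-\ge 0$, where $A_G$ is the node-arc incidence matrix (out-flow minus in-flow), and let $F$ be the face of $P$ in which $s^+_\ell=0$ for all $\ell\in L$ and $s^-_t=0$ for all $t\in T$. The circuits of a polyhedron $\{y: Ay=b,\ By\le d\}$ are the nonzero vectors $g\in\ker A$ with coprime integer components for which $Bg$ is support-minimal among all $Bh$ with $h\in\ker A\setminus\{0\}$. A circuit walk is a finite sequence of points of the polyhedron that starts at a vertex and in which each point arises from its predecessor by a step of positive, maximal feasible length along a circuit. To a partial matching $M\subseteq L\times T$ assign the point $y_M=(x,s^+,s^-)$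 where $x$ is the incidence vector of $M$, $s^+_t=1$ for the tasks $t\in T$ that are not matched by $M$, $s^-_\ell=1$ for the people $\ell\in L$ that are not matched by $M$, and all other entries of $s^+,s^-$ are $0$. Then the Hungarian Method (in its matrix form with starred and primed zeros and covered rows and columns, with arbitrary choices of the zeros that are treated next) performs a circuit walk over $F$: for every run on $C$, if $M_0=\emptyset,M_1,\dots,M_k$ are the partial matchings (sets of starred zeros) that are successively constructed by its greedy assignments and its augmentations, then $y_{M_0},y_{M_1},\dots,y_{M_k}$ is a circuit walk over $F$ (and also a circuit walk of $P$). Moreover, each greedy assignment and each augmentation along an inclusion-maximal alternating path changes the current matching $M$ to a matching $M'$ along a simple path from a person $\ell\in L$ to a task $t\in T$, both not matched by $M$; if $H_{\ell t}\in\{-1,0,1\}^{L\times T}$ is the signed incidence vector of this path ($+1$ on arcs traversed forward, $-1$ on arcs traversed backward), then $g=(H_{\ell t},-e_t,-e_\ell)$ is a circuit (of $P$ and of $F$), $y_{M'}=y_M+g$, and this is a step of maximal feasible length $1$ (in $P$ and in $F$). -/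

import Mathlib

open Matrix

noncomputable section

/-! ### Polyhedra, circuits and circuit walks -/

/-- A description `A x = b`, `B x ≤ d` of a polyhedron in `V → ℝ`; the equalities are indexed
by `E` and the inequalities by `I`. -/
structure LinSystem (E I V : Type*) where
  A : Matrix E V ℝ
  b : E → ℝ
  B : Matrix I V ℝ
  d : I → ℝ

namespace LinSystem

variable {E I V : Type*} [Fintype V]

/-- The polyhedron `{x | A x = b, B x ≤ d}`. -/
def toSet (P : LinSystem E I V) : Set (V → ℝ) :=
  {x | P.A *ᵥ x = P.b ∧ P.B *ᵥ x ≤ P.d}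

/-- The set of circuits: the nonzero `g ∈ ker A` with coprime integer components for which
`B g` is support-minimal among all `B h` with `h ∈ ker A`, `h ≠ 0`. -/
def circuits (P : LinSystem E I V) : Set (V → ℝ) :=
  {g | P.A *ᵥ g = 0 ∧ g ≠ 0 ∧
    (∃ z : V → ℤ, (∀ v, g v = (z v : ℝ)) ∧ Finset.univ.gcd z = 1) ∧
    ∀ h : V → ℝ, P.A *ᵥ h = 0 → h ≠ 0 →
      Function.support (P.B *ᵥ h) ⊆ Function.support (P.B *ᵥ g) →
      Function.support (P.B *ᵥ g) ⊆ Function.support (P.B *ᵥ h)}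

/-- `α > 0` is the maximal length of a feasible step from `x` in direction `g`. -/
def IsMaximalStep (P : LinSystem E I V) (x g : V → ℝ) (α : ℝ) : Prop :=
  0 < α ∧ x + α • g ∈ P.toSet ∧ ∀ β : ℝ, α < β → x + β • g ∉ P.toSet

/-- The finite sequence of points `w` is a circuit walk: it starts at a vertex, it stays in the
polyhedron, and each step is a step of maximal length along a circuit. -/
def IsCircuitWalk (P : LinSystem E I V) (w : List (V → ℝ)) : Prop :=
  (∃ v ∈ w.head?, v ∈ P.toSet.extremePoints ℝ) ∧
  (∀ x ∈ w, x ∈ P.toSet) ∧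
  w.IsChain fun x y => ∃ g ∈ P.circuits, ∃ α : ℝ, P.IsMaximalStep x g α ∧ y = x + α • g

/-- The polyhedron obtained by adding the equations `x (z k) = 0`. -/
def restrictZero [DecidableEq V] {K : Type*} (P : LinSystem E I V) (z : K → V) :
    LinSystem (E ⊕ K) I V where
  A := Matrix.fromRows P.A (Matrix.of fun k => Pi.single (z k) 1)
  b := Sum.elim P.b 0
  B := P.B
  d := P.d

end LinSystem

/-! ### Networks and pseudoflow polyhedra -/

/-- A directed network with node set `N` and arc set `A`. -/
structure Network (N A : Type*) where
  src : A → N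
  tgt : A → N

namespace Network

variable {N A : Type*} [DecidableEq N] [DecidableEq A]

/-- The node-arc incidence matrix: (`G.incidence *ᵥ x`) is out-flow minus in-flow. -/
def incidence (G : Network N A) : Matrix N A ℝ :=
  Matrix.of fun i a => (if G.src a = i then 1 else 0) - (if G.tgt a = i then 1 else 0)

/-- The pseudoflow polyhedron in the variables `(x, s⁺, s⁻)`, indexed by `A ⊕ N ⊕ N`:
`A_G x - s⁺ + s⁻ = b`, `x ≤ u`, and all variables are nonnegative. -/
def pseudo (G : Network N A) (b : N → ℝ) (u : A → ℝ) : LinSystem N (A ⊕ (A ⊕ N ⊕ N)) (A ⊕ N ⊕ N) where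
  A := Matrix.fromCols G.incidence (Matrix.fromCols (-1) 1)
  b := b
  B := Matrix.fromRows (Matrix.fromCols 1 0) (-1)
  d := Sum.elim u 0

/-- A traversal of an arc; `true` means in the direction of the arc, `false` means against it. -/
abbrev Dart (A : Type*) := A × Bool

/-- The node at which a traversal of an arc starts. -/
def first (G : Network N A) (e : Dart A) : N := if e.2 then G.src e.1 else G.tgt e.1

/-- The node at which a traversal of an arc ends. -/
def last (G : Network N A) (e : Dart A) : N := if e.2 then G.tgt e.1 else G.src e.1

/-- `p` is a walk from `i` to `j` in the underlying undirected network. -/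
inductive IsWalk (G : Network N A) : N → N → List (Dart A) → Prop
  | nil (i : N) : IsWalk G i i []
  | cons (e : Dart A) {j : N} {p : List (Dart A)} :
      IsWalk G (G.last e) j p → IsWalk G (G.first e) j (e :: p)

/-- `p` is a (simple) path from `i` to `j` in the underlying undirected network. -/
def IsPath (G : Network N A) (i j : N) (p : List (Dart A)) : Prop :=
  G.IsWalk i j p ∧ (i :: p.map G.last).Nodup

/-- The signed incidence vector of a path: `1` on forward arcs, `-1` on backward arcs. -/
def pathVec (p : List (Dart A)) (a : A) : ℝ := (p.count (a, true) : ℝ) - (p.count (a, false) : ℝ)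

/-- The vector `(H, -e_j, -e_i)` for a path `H` from `i` to `j`, given by `p`. -/
def pathCircuit (i j : N) (p : List (Dart A)) : A ⊕ N ⊕ N → ℝ :=
  Sum.elim (pathVec p) (Sum.elim (-Pi.single j 1) (-Pi.single i 1))

end Network

/-! ### The assignment problem -/

section Assignment

variable (L T : Type*)

/-- The complete bipartite network with the arcs `(ℓ, t)` from `L` to `T`. -/
def assignmentNetwork : Network (L ⊕ T) (L × T) where
  src a := Sum.inl a.1
  tgt a := Sum.inr a.2

variable [DecidableEq L] [DecidableEq T]

/-- The pseudoflow polyhedron of the assignment problem: `b = 1` on `L`, `b = -1` on `T`, and all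
capacities are `1`. -/
def assignmentPoly : LinSystem (L ⊕ T) ((L × T) ⊕ ((L × T) ⊕ (L ⊕ T) ⊕ (L ⊕ T)))
    ((L × T) ⊕ (L ⊕ T) ⊕ (L ⊕ T)) :=
  (assignmentNetwork L T).pseudo (Sum.elim 1 (-1)) 1

/-- The face in which `s⁺_ℓ = 0` for all `ℓ ∈ L` and `s⁻_t = 0` for all `t ∈ T`. -/
def assignmentFace [Fintype L] [Fintype T] :
    LinSystem ((L ⊕ T) ⊕ (L ⊕ T)) ((L × T) ⊕ ((L × T) ⊕ (L ⊕ T) ⊕ (L ⊕ T)))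
      ((L × T) ⊕ (L ⊕ T) ⊕ (L ⊕ T)) :=
  (assignmentPoly L T).restrictZero
    (Sum.elim (fun l => Sum.inr (Sum.inl (Sum.inl l))) (fun t => Sum.inr (Sum.inr (Sum.inr t))))

end Assignment

section Hungarian

variable {L T : Type*}

/-- The point `(x, s⁺, s⁻)` of a partial matching `M`: `x` is the incidence vector of `M`,
`s⁺` is the incidence vector of the unmatched tasks, `s⁻` that of the unmatched people. -/
def matchingPoint (M : Set (L × T)) : (L × T) ⊕ (L ⊕ T) ⊕ (L ⊕ T) → ℝ :=
  Sum.elim (M.indicator 1) (Sum.elim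
    (Sum.elim 0 ({t | ∀ l, (l, t) ∉ M}.indicator 1))
    (Sum.elim ({l | ∀ t, (l, t) ∉ M}.indicator 1) 0))

/-! ### The Hungarian Method -/

/-- The control state of the Hungarian Method: the greedy loop, the head of the main loop (where
its condition is tested), the body of the main loop, and termination. -/
inductive HMPhase
  | greedy
  | head
  | body
  | done

/-- A state of the Hungarian Method: the current cost matrix, the starred and the primed zeros,
the covered rows and columns. -/
structure HMState (L T : Type*) where
  phase : HMPhase
  cost : L → T → ℝ
  star : Set (L × T)
  prime : Set (L × T)
  rowCov : Set L
  colCov : Set T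

/-- Subtract the smallest element from each row. -/
def reduceRows (C : L → T → ℝ) : L → T → ℝ := fun l t => C l t - ⨅ t', C l t'

/-- Subtract the smallest element from each column. -/
def reduceCols (C : L → T → ℝ) : L → T → ℝ := fun l t => C l t - ⨅ l', C l' t

namespace HMState

/-- The state after the row and column subtractions at the beginning. -/
def init (C : L → T → ℝ) : HMState L T where
  phase := HMPhase.greedy
  cost := reduceCols (reduceRows C)
  star := ∅
  prime := ∅
  rowCov := ∅
  colCov := ∅

/-- The entry at `(l, t)` is in no covered row or column. -/
def Uncovered (σ : HMState L T) (l : L) (t : T) : Prop := l ∉ σ.rowCov ∧ t ∉ σ.colCov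

/-- The entry at `(l, t)` is an uncovered zero. -/
def UncoveredZero (σ : HMState L T) (l : L) (t : T) : Prop := σ.Uncovered l t ∧ σ.cost l t = 0

/-- Some starred zero is in row `l`. -/
def RowStarred (S : Set (L × T)) (l : L) : Prop := ∃ t, (l, t) ∈ S

/-- Some starred zero is in column `t`. -/
def ColStarred (S : Set (L × T)) (t : T) : Prop := ∃ l, (l, t) ∈ S

end HMState

/-- `p` is an alternating path of primed zeros (in `Q`) and starred zeros (in `S`) that begins with
the primed zero at `(l, t)` and ends with a primed zero. A zero at `(l, t)` is identified with the
arc `(l, t)`, primed zeros being traversed from `L` to `T` and starred zeros from `T` to `L`; so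
two consecutive zeros share a column (from a primed to a starred one) or a row. -/
def IsAlternating (S Q : Set (L × T)) (l : L) (t : T) (p : List (Network.Dart (L × T))) : Prop :=
  (∃ t' : T, (assignmentNetwork L T).IsPath (Sum.inl l) (Sum.inr t') p) ∧
  p.head? = some ((l, t), true) ∧
  (∀ a, (a, true) ∈ p → a ∈ Q) ∧ (∀ a, (a, false) ∈ p → a ∈ S)

/-- `p` is an inclusion-maximal alternating path as in `IsAlternating`. -/
def IsMaxAlternating (S Q : Set (L × T)) (l : L) (t : T)
    (p : List (Network.Dart (L × T))) : Prop :=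
  IsAlternating S Q l t p ∧ ∀ q, IsAlternating S Q l t q → p ⊆ q → q ⊆ p

/-- Unstar each starred zero in the path and star each primed zero in it. -/
def flipStars (S : Set (L × T)) (p : List (Network.Dart (L × T))) : Set (L × T) :=
  (S \ {a | (a, false) ∈ p}) ∪ {a | (a, true) ∈ p}

open HMState in
open Classical in
/-- One step of the Hungarian Method. The zero that is treated next in a loop over zeros is
arbitrary. A step that changes the set of starred zeros carries the label `some p`, where `p` is
the path along which the assignment is changed (a single arc for a greedy assignment); all other
steps carry the label `none`. -/
inductive HMStep : HMState L T → Option (List (Network.Dart (L × T))) → HMState L T → Prop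
  /-- Greedy loop: star a zero without starred zeros in its row and in its column. -/
  | assign (σ : HMState L T) (l : L) (t : T) (hphase : σ.phase = HMPhase.greedy)
      (hzero : σ.cost l t = 0) (hrow : ¬ RowStarred σ.star l) (hcol : ¬ ColStarred σ.star t) :
      HMStep σ (some [((l, t), true)]) { σ with star := insert (l, t) σ.star }
  /-- End of the greedy loop: cover every column that contains a starred zero. -/
  | cover (σ : HMState L T) (hphase : σ.phase = HMPhase.greedy)
      (hmax : ∀ l t, σ.cost l t = 0 → RowStarred σ.star l ∨ ColStarred σ.star t) :
      HMStep σ none { σ with phase := HMPhase.head, colCov := {t | ColStarred σ.star t} }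
  /-- Head of the main loop: there is an uncovered zero. -/
  | enter (σ : HMState L T) (hphase : σ.phase = HMPhase.head)
      (h : ∃ l t, σ.UncoveredZero l t) :
      HMStep σ none { σ with phase := HMPhase.body }
  /-- Head of the main loop: there is no uncovered zero. -/
  | exit (σ : HMState L T) (hphase : σ.phase = HMPhase.head)
      (h : ¬ ∃ l t, σ.UncoveredZero l t) :
      HMStep σ none { σ with phase := HMPhase.done }
  /-- Prime an uncovered zero whose row contains a starred zero; cover this row and uncover the
  column of the starred zero. -/
  | prime (σ : HMState L T) (l : L) (t ts : T) (hphase : σ.phase = HMPhase.body)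
      (hzero : σ.UncoveredZero l t) (hstar : (l, ts) ∈ σ.star) :
      HMStep σ none { σ with
        prime := insert (l, t) σ.prime
        rowCov := insert l σ.rowCov
        colCov := σ.colCov \ {ts} }
  /-- Prime an uncovered zero whose row contains no starred zero; augment along an
  inclusion-maximal alternating path, erase all primes, uncover every row, cover every column with
  a starred zero, and terminate if all columns are covered. -/
  | augment (σ : HMState L T) (l : L) (t : T) (p : List (Network.Dart (L × T)))
      (hphase : σ.phase = HMPhase.body) (hzero : σ.UncoveredZero l t)
      (hrow : ¬ RowStarred σ.star l)
      (hp : IsMaxAlternating σ.star (insert (l, t) σ.prime) l t p) :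
      HMStep σ (some p) { σ with
        phase := if ∀ t', ColStarred (flipStars σ.star p) t' then HMPhase.done else HMPhase.body
        star := flipStars σ.star p
        prime := ∅
        rowCov := ∅
        colCov := {t' | ColStarred (flipStars σ.star p) t'} }
  /-- No uncovered zeros are left: with the smallest uncovered element `h`, attained at `(l, t)`,
  add `h` to each covered row and subtract `h` from each uncovered column. -/
  | adjust (σ : HMState L T) (l : L) (t : T) (hphase : σ.phase = HMPhase.body)
      (hnone : ¬ ∃ l' t', σ.UncoveredZero l' t') (hunc : σ.Uncovered l t)
      (hmin : ∀ l' t', σ.Uncovered l' t' → σ.cost l t ≤ σ.cost l' t') :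
      HMStep σ none { σ with
        phase := HMPhase.head
        cost := fun l' t' => σ.cost l' t' + (if l' ∈ σ.rowCov then σ.cost l t else 0)
          - (if t' ∉ σ.colCov then σ.cost l t else 0) }

/-- `HungarianRun C σ Ms`: a (partial or complete) run of the Hungarian Method on the cost matrix
`C` leads to the state `σ`, and `Ms` is the list of the partial matchings (sets of starred zeros)
constructed in this run, in order, from the empty one on; each greedy assignment and each
augmentation contributes one entry. -/
inductive HungarianRun (C : L → T → ℝ) : HMState L T → List (Set (L × T)) → Prop
  | start : HungarianRun C (HMState.init C) [∅]
  | silent {σ σ' : HMState L T} {Ms : List (Set (L × T))} :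
      HungarianRun C σ Ms → HMStep σ none σ' → HungarianRun C σ' Ms
  | update {σ σ' : HMState L T} {Ms : List (Set (L × T))} {p : List (Network.Dart (L × T))} :
      HungarianRun C σ Ms → HMStep σ (some p) σ' → HungarianRun C σ' (Ms ++ [σ'.star])

end Hungarian

end

/-! ### Faces obtained by fixing nonnegative variables to zero. -/

namespace LinSystem

variable {E I V : Type*} [Fintype V]

/-! Two facts carry the theorem, one polyhedral and one combinatorial.

Polyhedral: let `g` be the signed vector of a simple path from `i` to `j`, with slack entries `-1`
at both ends. A kernel vector supported inside the support of `g` is a flow on the path that is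
conserved at its inner nodes, hence a multiple of `g`; so `g` is a circuit
(`IsPath.eq_smul_pathVec`, `IsPath.pathCircuit_mem_circuits`). If the path alternates between a
matching `M` and its complement and joins two unmatched nodes, then adding `g` to the point of `M`
gives a point of the face with 0/1 arc part, and such points are exactly those of matchings
(`eq_matchingPoint_of_mem_face`). Length 1 is maximal because the slack of the end task drops from 1
to 0 (`isMatchingStep_flipStars`).

Combinatorial: every inclusion-maximal alternating path must end at an unmatched task. Rank the
primed rows by the time of priming. Following a primed zero to the star in its column leads to a
primed row of smaller rank. So a path ending in a starred column could be prolonged by that star and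
a prime in its row without revisiting a node (`PrimesRanked.exists_of_isMaxAlternating`). The
ranking is part of an invariant of all runs that involves stars, primes and covers but no costs. -/

theorem mem_restrictZero [DecidableEq V] {K : Type*} (P : LinSystem E I V) (z : K → V)
    (x : V → ℝ) : x ∈ (P.restrictZero z).toSet ↔ x ∈ P.toSet ∧ ∀ k, x (z k) = 0 := by
  simp only [restrictZero, toSet, Set.mem_ofPred_eq, Matrix.fromRows_mulVec]
  rw [Sum.elim_eq_iff]
  simp only [funext_iff, Matrix.mulVec, Matrix.of_apply, single_one_dotProduct, Pi.zero_apply]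
  tauto

theorem restrictZero_ker [DecidableEq V] {K : Type*} (P : LinSystem E I V) (z : K → V)
    (x : V → ℝ) : (P.restrictZero z).A *ᵥ x = 0 ↔ P.A *ᵥ x = 0 ∧ ∀ k, x (z k) = 0 := by
  have h0 : (0 : E ⊕ K → ℝ) = Sum.elim (0 : E → ℝ) (0 : K → ℝ) := by ext (_ | _) <;> rfl
  simp only [restrictZero, Matrix.fromRows_mulVec]
  rw [h0, Sum.elim_eq_iff]
  simp only [funext_iff, Matrix.mulVec, Matrix.of_apply, single_one_dotProduct, Pi.zero_apply]

/-- Extra equations only shrink the kernel while `B` stays the same, so fewer vectors compete for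
minimal support. -/
theorem circuits_restrictZero [DecidableEq V] {K : Type*} {P : LinSystem E I V} {z : K → V}
    {g : V → ℝ} (hg : g ∈ P.circuits) (hz : ∀ k, g (z k) = 0) :
    g ∈ (P.restrictZero z).circuits := by
  obtain ⟨h1, h2, h3, h4⟩ := hg
  exact ⟨(restrictZero_ker P z g).2 ⟨h1, hz⟩, h2, h3,
    fun h hh => h4 h ((restrictZero_ker P z h).1 hh).1⟩

theorem IsMaximalStep.restrictZero [DecidableEq V] {K : Type*} {P : LinSystem E I V} {z : K → V}
    {x g : V → ℝ} {α : ℝ} (h : P.IsMaximalStep x g α)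
    (hx : x + α • g ∈ (P.restrictZero z).toSet) : (P.restrictZero z).IsMaximalStep x g α :=
  ⟨h.1, hx, fun β hβ hmem => h.2.2 β hβ ((mem_restrictZero P z _).1 hmem).1⟩

/-- A polyhedron in nonnegative variables: fixing some of the variables to zero gives a face. -/
theorem isExposed_restrictZero [DecidableEq V] {K : Type*} [Fintype K] (P : LinSystem E I V)
    (z : K → V) (hnonneg : ∀ x ∈ P.toSet, ∀ k, 0 ≤ x (z k)) :
    IsExposed ℝ P.toSet (P.restrictZero z).toSet := by
  rintro ⟨x₀, hx₀⟩
  rw [mem_restrictZero] at hx₀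
  -- The exposing functional is minus the sum of the fixed variables; its maximum 0 is attained at
  -- `x₀`.
  refine ⟨-∑ k, ContinuousLinearMap.proj (R := ℝ) (φ := fun _ : V => ℝ) (z k), ?_⟩
  ext x
  simp only [mem_restrictZero, Set.mem_ofPred_eq, and_congr_right_iff, _root_.neg_apply,
    _root_.sum_apply, ContinuousLinearMap.proj_apply, neg_le_neg_iff]
  intro hx
  constructor
  · intro h y hy
    simp only [h, Finset.sum_const_zero]
    exact Finset.sum_nonneg fun k _ => hnonneg y hy k
  · intro h k
    have h1 := h x₀ hx₀.1
    simp only [hx₀.2, Finset.sum_const_zero] at h1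
    have h2 := (Finset.sum_eq_zero_iff_of_nonneg fun k _ => hnonneg x hx k).1
      (le_antisymm h1 (Finset.sum_nonneg fun k _ => hnonneg x hx k))
    exact h2 k (Finset.mem_univ k)

end LinSystem

/-! ### Walks, path flows and circuits of pseudoflow polyhedra. -/

namespace Network

section Walks

variable {N A : Type*}

theorem isWalk_cons_iff {G : Network N A} {i j : N} {e : Dart A} {p : List (Dart A)} :
    G.IsWalk i j (e :: p) ↔ G.first e = i ∧ G.IsWalk (G.last e) j p := by
  constructor
  · intro h; cases h with
    | cons e h => exact ⟨rfl, h⟩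
  · rintro ⟨rfl, h⟩; exact .cons e h

theorem isWalk_nil_iff {G : Network N A} {i j : N} : G.IsWalk i j [] ↔ i = j := by
  constructor
  · intro h; cases h; rfl
  · rintro rfl; exact .nil i

theorem IsWalk.append {G : Network N A} {i j k : N} {p q : List (Dart A)}
    (hp : G.IsWalk i j p) (hq : G.IsWalk j k q) : G.IsWalk i k (p ++ q) := by
  induction hp with
  | nil => exact hq
  | cons e _ ih => exact .cons e (ih hq)

theorem IsWalk.last_mem {G : Network N A} {i j : N} {p : List (Dart A)} (hp : G.IsWalk i j p) :
    j ∈ i :: p.map G.last := by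
  induction hp with
  | nil => simp
  | cons e _ ih => simpa using Or.inr ih

theorem IsWalk.first_mem {G : Network N A} {i j : N} {p : List (Dart A)} (hp : G.IsWalk i j p)
    {e : Dart A} (he : e ∈ p) : G.first e ∈ i :: p.map G.last := by
  induction hp with
  | nil => simp at he
  | cons e' _ ih =>
    rcases List.mem_cons.1 he with rfl | he
    · simp
    · exact List.mem_cons_of_mem _ (by simpa using ih he)

/-- Lets facts about walks into `j` be applied at every node that the walk visits; the inclusion of
darts is all that is needed to inherit hypotheses on `p`. -/
theorem IsWalk.exists_suffix {G : Network N A} {i j : N} {p : List (Dart A)}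
    (hp : G.IsWalk i j p) {v : N} (hv : v ∈ i :: p.map G.last) :
    ∃ q, q ⊆ p ∧ G.IsWalk v j q := by
  induction hp with
  | nil i =>
    obtain rfl : v = i := by simpa using hv
    exact ⟨[], by simp, .nil _⟩
  | cons e h ih =>
    rcases List.mem_cons.1 hv with rfl | hv
    · exact ⟨_, List.Subset.refl _, .cons e h⟩
    · obtain ⟨q, hq, hw⟩ := ih (by simpa using hv)
      exact ⟨q, List.subset_cons_of_subset _ hq, hw⟩

theorem IsWalk.src_tgt_mem {G : Network N A} {i j : N} {p : List (Dart A)} (hp : G.IsWalk i j p)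
    {e : Dart A} (he : e ∈ p) :
    G.src e.1 ∈ i :: p.map G.last ∧ G.tgt e.1 ∈ i :: p.map G.last := by
  have h1 := hp.first_mem he
  have h2 : G.last e ∈ i :: p.map G.last := List.mem_cons_of_mem _ (List.mem_map_of_mem he)
  obtain ⟨a, s⟩ := e
  cases s
  · exact ⟨h2, h1⟩
  · exact ⟨h1, h2⟩

theorem IsPath.nodup {G : Network N A} {i j : N} {p : List (Dart A)} (hp : G.IsPath i j p) :
    p.Nodup :=
  (List.nodup_cons.1 hp.2).2.of_map _

end Walks

variable {N A : Type*} [DecidableEq N] [DecidableEq A]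

theorem pseudo_mulVec [Fintype N] [Fintype A] (G : Network N A) (b : N → ℝ) (u : A → ℝ)
    (y : A ⊕ N ⊕ N → ℝ) :
    (G.pseudo b u).A *ᵥ y =
      fun i => (G.incidence *ᵥ (y ∘ Sum.inl)) i - y (.inr (.inl i)) + y (.inr (.inr i)) := by
  ext i
  simp only [pseudo, Matrix.fromCols_mulVec, Matrix.neg_mulVec, Matrix.one_mulVec, Pi.add_apply,
    Pi.neg_apply, Function.comp_apply]
  ring

theorem mem_pseudo [Fintype N] [Fintype A] (G : Network N A) (b : N → ℝ) (u : A → ℝ)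
    (y : A ⊕ N ⊕ N → ℝ) :
    y ∈ (G.pseudo b u).toSet ↔
      (∀ i, (G.incidence *ᵥ (y ∘ Sum.inl)) i - y (.inr (.inl i)) + y (.inr (.inr i)) = b i) ∧
      (∀ a, y (.inl a) ≤ u a) ∧ ∀ v, 0 ≤ y v := by
  simp only [LinSystem.toSet, Set.mem_ofPred_eq, pseudo_mulVec]
  simp only [pseudo, funext_iff, Matrix.fromRows_mulVec, Matrix.fromCols_mulVec,
    Matrix.one_mulVec, Matrix.zero_mulVec, Matrix.neg_mulVec, add_zero, Pi.le_def, Sum.forall,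
    Sum.elim_inl, Sum.elim_inr, Function.comp_apply, Pi.neg_apply, Pi.zero_apply, neg_nonpos]

/-- The nonnegativity rows already list every variable and the capacity rows only repeat the arcs,
so minimality can be tested on the vectors themselves. -/
theorem pseudo_support_iff [Fintype N] [Fintype A] (G : Network N A) (b : N → ℝ) (u : A → ℝ)
    (g h : A ⊕ N ⊕ N → ℝ) :
    Function.support ((G.pseudo b u).B *ᵥ h) ⊆ Function.support ((G.pseudo b u).B *ᵥ g) ↔
      ∀ v, h v ≠ 0 → g v ≠ 0 := by
  simp only [pseudo, Set.subset_def, Function.mem_support, Matrix.fromRows_mulVec,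
    Matrix.fromCols_mulVec, Matrix.one_mulVec, Matrix.zero_mulVec, Matrix.neg_mulVec, add_zero,
    Sum.forall, Sum.elim_inl, Sum.elim_inr, Function.comp_apply, Pi.neg_apply, neg_ne_zero]
  tauto

theorem incidence_mulVec_single [Fintype A] (G : Network N A) (a : A) :
    G.incidence *ᵥ (Pi.single a 1) = Pi.single (G.src a) 1 - Pi.single (G.tgt a) 1 := by
  ext i
  simp [incidence, Matrix.mulVec_single, Pi.single_apply, eq_comm]

theorem pathVec_nil : pathVec ([] : List (Dart A)) = 0 := by
  ext a; simp [pathVec]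

theorem pathVec_cons (e : Dart A) (p : List (Dart A)) :
    pathVec (e :: p) = (if e.2 then 1 else -1 : ℝ) • Pi.single e.1 1 + pathVec p := by
  obtain ⟨a, s⟩ := e
  ext a'
  by_cases h : a = a'
  · subst h; cases s <;> simp [pathVec] <;> ring
  · cases s <;> simp [pathVec, h, Ne.symm h]

theorem pathVec_eq_zero {p : List (Dart A)} {a : A} (h : ∀ s, (a, s) ∉ p) : pathVec p a = 0 := by
  simp [pathVec, List.count_eq_zero_of_not_mem (h _)]

theorem pathVec_of_nodup {p : List (Dart A)} (hp : p.Nodup) (a : A) :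
    pathVec p a = (if (a, true) ∈ p then 1 else 0) - if (a, false) ∈ p then 1 else 0 := by
  rw [pathVec, List.Nodup.count hp, List.Nodup.count hp]
  split_ifs <;> simp

theorem incidence_mulVec_dart [Fintype A] (G : Network N A) (e : Dart A) :
    G.incidence *ᵥ ((if e.2 then 1 else -1 : ℝ) • Pi.single e.1 1) =
      Pi.single (G.first e) 1 - Pi.single (G.last e) 1 := by
  obtain ⟨a, s⟩ := e
  rw [Matrix.mulVec_smul, incidence_mulVec_single]
  cases s <;> simp [first, last]

theorem IsWalk.incidence_pathVec [Fintype A] {G : Network N A} {i j : N} {p : List (Dart A)}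
    (hp : G.IsWalk i j p) :
    G.incidence *ᵥ pathVec p = Pi.single i 1 - Pi.single j 1 := by
  induction hp with
  | nil i => simp [pathVec_nil]
  | cons e _ ih =>
    rw [pathVec_cons, Matrix.mulVec_add, ih, incidence_mulVec_dart]
    abel

omit [DecidableEq A] in
theorem incidence_mulVec_apply_eq_zero [Fintype A] (G : Network N A) (h : A → ℝ) (i : N)
    (hi : ∀ a, h a ≠ 0 → G.src a ≠ i ∧ G.tgt a ≠ i) : (G.incidence *ᵥ h) i = 0 := by
  refine Finset.sum_eq_zero fun a _ => ?_
  by_cases ha : h a = 0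
  · simp [ha]
  · simp [incidence, hi a ha]

/-- A flow on the arcs of a path that is conserved at the inner nodes is a multiple of the signed
incidence vector of the path. -/
theorem IsPath.eq_smul_pathVec [Fintype A] {G : Network N A} {i j : N} {p : List (Dart A)}
    (hp : G.IsPath i j p) (h : A → ℝ) (hsupp : ∀ a, h a ≠ 0 → ∃ s, (a, s) ∈ p)
    (hcons : ∀ v, v ≠ i → v ≠ j → (G.incidence *ᵥ h) v = 0) :
    h = (G.incidence *ᵥ h) i • pathVec p := by
  obtain ⟨hw, hnd⟩ := hp
  induction hw generalizing h with
  | nil i =>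
    have : h = 0 := by
      ext a; by_contra ha; obtain ⟨s, hs⟩ := hsupp a ha; simp at hs
    simp [this]
  | @cons e j p hw ih =>
    rw [List.map_cons, List.nodup_cons] at hnd
    obtain ⟨hi, hnd⟩ := hnd
    have hfl : G.first e ≠ G.last e := fun heq => hi (heq ▸ List.mem_cons_self)
    have hout : ∀ s, (e.1, s) ∉ p := by
      intro s hs
      have := hw.src_tgt_mem hs
      apply hi
      unfold first
      split_ifs
      exacts [this.1, this.2]
    -- The orientation sign of the first arc, which is its own inverse.
    set c : ℝ := if e.2 then 1 else -1 with hc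
    have hcc : c * c = 1 := by rw [hc]; split_ifs <;> norm_num
    -- Removing the first arc leaves a flow on the rest of the path, to which induction applies; the
    -- first node does not lie on that rest, so its balance is due to the first arc alone.
    set k : A → ℝ := h - (h e.1) • Pi.single e.1 1 with hk
    have hke : k e.1 = 0 := by simp [hk]
    have hka : ∀ a, a ≠ e.1 → k a = h a := fun a ha => by simp [hk, ha]
    have hksupp : ∀ a, k a ≠ 0 → ∃ s, (a, s) ∈ p := by
      intro a ha
      have hne : a ≠ e.1 := by rintro rfl; exact ha hke
      rw [hka a hne] at ha
      obtain ⟨s, hs⟩ := hsupp a ha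
      rcases List.mem_cons.1 hs with rfl | hs
      · exact absurd rfl hne
      · exact ⟨s, hs⟩
    have hki : (G.incidence *ᵥ k) (G.first e) = 0 := by
      refine incidence_mulVec_apply_eq_zero G k _ fun a ha => ?_
      obtain ⟨s, hs⟩ := hksupp a ha
      have := hw.src_tgt_mem hs
      exact ⟨fun h => hi (h ▸ this.1), fun h => hi (h ▸ this.2)⟩
    have hinc : G.incidence *ᵥ h = G.incidence *ᵥ k +
        (h e.1 * c) • (Pi.single (G.first e) 1 - Pi.single (G.last e) 1) := by
      rw [← incidence_mulVec_dart, ← Matrix.mulVec_smul, ← Matrix.mulVec_add, smul_smul, ← hc,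
        mul_assoc, hcc, mul_one, hk, sub_add_cancel]
    have hval : (G.incidence *ᵥ h) (G.first e) = h e.1 * c := by
      rw [hinc]; simp [hki, hfl]
    have hkeq := ih k hksupp (by
      intro v hv hvj
      by_cases hvi : v = G.first e
      · rw [hvi, hki]
      · have := hcons v hvi hvj
        rw [hinc] at this
        simpa [hvi, hv] using this) hnd
    have hkc : k = (h e.1 * c) • pathVec p := by
      rw [hkeq]
      -- On an empty rest both sides vanish; otherwise the end of the first arc is an inner node,
      -- and conservation there identifies the two coefficients.
      cases p with
      | nil => simp [pathVec_nil]
      | cons e' p' =>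
        have hlj : G.last e ≠ j := by
          rintro rfl
          have := (isWalk_cons_iff.1 hw).2.last_mem
          rw [List.map_cons, List.nodup_cons] at hnd
          exact hnd.1 this
        have := hcons (G.last e) hfl.symm hlj
        rw [hinc] at this
        simp only [Pi.add_apply, Pi.smul_apply, Pi.sub_apply, Pi.single_eq_same,
          Pi.single_eq_of_ne hfl.symm, smul_eq_mul] at this
        congr 1
        linarith
    rw [hval, pathVec_cons, smul_add, ← hkc, smul_smul, ← hc, mul_assoc, hcc, mul_one, hk]
    abel

theorem pathCircuit_ker [Fintype N] [Fintype A] {G : Network N A} {i j : N} {p : List (Dart A)}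
    (hp : G.IsWalk i j p) (b : N → ℝ) (u : A → ℝ) :
    (G.pseudo b u).A *ᵥ pathCircuit i j p = 0 := by
  rw [pseudo_mulVec]
  have h : pathCircuit i j p ∘ Sum.inl = pathVec p := rfl
  ext v
  rw [h, hp.incidence_pathVec]
  simp [pathCircuit]

theorem IsPath.pathCircuit_mem_circuits [Fintype N] [Fintype A] {G : Network N A} {i j : N}
    {p : List (Dart A)} (hp : G.IsPath i j p) (hij : i ≠ j) (b : N → ℝ) (u : A → ℝ) :
    pathCircuit i j p ∈ (G.pseudo b u).circuits := by
  refine ⟨pathCircuit_ker hp.1 b u, ?_, ?_, ?_⟩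
  · intro h
    have := congrFun h (.inr (.inl j))
    simp [pathCircuit] at this
  · refine ⟨Sum.elim (fun a => (p.count (a, true) : ℤ) - p.count (a, false))
      (Sum.elim (-Pi.single j 1) (-Pi.single i 1)), ?_, ?_⟩
    · rintro (a | v | v)
      · simp [pathCircuit, pathVec]
      · by_cases h : v = j <;> simp [pathCircuit, h]
      · by_cases h : v = i <;> simp [pathCircuit, h]
    -- The slack entry `-1` at `j` is a unit, so the entries are coprime.
    · rw [← Finset.normalize_gcd, normalize_eq_one]
      refine isUnit_of_dvd_unit (Finset.gcd_dvd (Finset.mem_univ (.inr (.inl j)))) ?_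
      simp
  · intro h hker hne hsub
    rw [pseudo_support_iff] at hsub ⊢
    rw [pseudo_mulVec] at hker
    have hplus : ∀ v, v ≠ j → h (.inr (.inl v)) = 0 := by
      intro v hv; by_contra h0; exact hsub _ h0 (by simp [pathCircuit, hv])
    have hminus : ∀ v, v ≠ i → h (.inr (.inr v)) = 0 := by
      intro v hv; by_contra h0; exact hsub _ h0 (by simp [pathCircuit, hv])
    -- Away from `i` and `j` both slacks of `h` vanish, so its arc part is conserved there.
    have hx := hp.eq_smul_pathVec (h ∘ Sum.inl)
      (fun a ha => by
        by_contra! h0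
        exact hsub _ ha (pathVec_eq_zero h0))
      (fun v hvi hvj => by
        have := congrFun hker v
        simpa [hplus v hvj, hminus v hvi] using this)
    set c := (G.incidence *ᵥ (h ∘ Sum.inl)) i
    have hinc : G.incidence *ᵥ (h ∘ Sum.inl) = c • (Pi.single i 1 - Pi.single j 1) := by
      rw [hx, Matrix.mulVec_smul, hp.1.incidence_pathVec]
    rw [hinc] at hker
    have heq : h = c • pathCircuit i j p := by
      -- The balance equations at `j` and at `i` determine the two remaining slacks; `i ≠ j` ensures
      -- that only one slack survives at each end.
      ext (a | v | v)
      · exact congrFun hx a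
      · by_cases hv : v = j
        · subst hv
          have := congrFun hker v
          simp [hminus v hij.symm, hij.symm] at this
          simp [pathCircuit]; linarith
        · simp [hplus v hv, pathCircuit, hv]
      · by_cases hv : v = i
        · subst hv
          have := congrFun hker v
          simp [hplus v hij, hij] at this
          simp [pathCircuit]; linarith
        · simp [hminus v hv, pathCircuit, hv]
    have hc : c ≠ 0 := by
      rintro h0; rw [h0, zero_smul] at heq; exact hne heq
    intro v hv
    rw [heq]
    simpa [hc] using hv

end Network

/-! ### Matchings as points of the face, and augmentations as maximal circuit steps. -/

section Matchings

variable {L T : Type*}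

/-- `M` is a partial matching: no two of its pairs share a row or a column. -/
def IsPartialMatching (M : Set (L × T)) : Prop :=
  (∀ l t t', (l, t) ∈ M → (l, t') ∈ M → t = t') ∧ ∀ l l' t, (l, t) ∈ M → (l', t) ∈ M → l = l'

variable [Fintype L] [Fintype T] [DecidableEq L] [DecidableEq T]

theorem assignment_incidence_inl (x : L × T → ℝ) (l : L) :
    ((assignmentNetwork L T).incidence *ᵥ x) (.inl l) = ∑ t, x (l, t) := by
  simp [Network.incidence, assignmentNetwork, Matrix.mulVec, dotProduct, Fintype.sum_prod_type,
    Finset.sum_comm (γ := L)]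

theorem assignment_incidence_inr (x : L × T → ℝ) (t : T) :
    ((assignmentNetwork L T).incidence *ᵥ x) (.inr t) = -∑ l, x (l, t) := by
  simp [Network.incidence, assignmentNetwork, Matrix.mulVec, dotProduct, Fintype.sum_prod_type]

theorem mem_assignmentFace (y : (L × T) ⊕ (L ⊕ T) ⊕ (L ⊕ T) → ℝ) :
    y ∈ (assignmentFace L T).toSet ↔
      (∀ l, ∑ t, y (.inl (l, t)) + y (.inr (.inr (.inl l))) = 1) ∧
      (∀ t, ∑ l, y (.inl (l, t)) + y (.inr (.inl (.inr t))) = 1) ∧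
      (∀ a, y (.inl a) ≤ 1) ∧ (∀ v, 0 ≤ y v) ∧
      (∀ l, y (.inr (.inl (.inl l))) = 0) ∧ ∀ t, y (.inr (.inr (.inr t))) = 0 := by
  rw [assignmentFace, LinSystem.mem_restrictZero, assignmentPoly, Network.mem_pseudo]
  simp only [Sum.forall, assignment_incidence_inl, assignment_incidence_inr, Sum.elim_inl,
    Sum.elim_inr, Pi.one_apply, Pi.neg_apply, Function.comp_apply]
  constructor
  · rintro ⟨⟨⟨h1, h2⟩, h3, h4⟩, h5, h6⟩
    refine ⟨fun l => ?_, fun t => ?_, h3, h4, h5, h6⟩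
    · have := h1 l; rw [h5] at this; linarith
    · have := h2 t; rw [h6] at this; linarith
  · rintro ⟨h1, h2, h3, h4, h5, h6⟩
    refine ⟨⟨⟨fun l => ?_, fun t => ?_⟩, h3, h4⟩, h5, h6⟩
    · rw [h5]; linarith [h1 l]
    · rw [h6]; linarith [h2 t]

theorem assignmentFace_subset : (assignmentFace L T).toSet ⊆ (assignmentPoly L T).toSet :=
  fun _ hx => ((LinSystem.mem_restrictZero _ _ _).1 hx).1

theorem sum_indicator_eq_one {ι : Type*} [Fintype ι] {S : Set ι} {i : ι} (hi : i ∈ S)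
    (huniq : ∀ j ∈ S, j = i) : ∑ j, S.indicator (1 : ι → ℝ) j = 1 := by
  rw [Finset.sum_eq_single i]
  · simp [hi]
  · intro j _ hj
    exact Set.indicator_of_notMem (fun h => hj (huniq j h)) _
  · simp

theorem matchingPoint_mem_face {M : Set (L × T)} (hM : IsPartialMatching M) :
    matchingPoint M ∈ (assignmentFace L T).toSet := by
  classical
  rw [mem_assignmentFace]
  refine ⟨fun l => ?_, fun t => ?_, fun a => ?_, ?_, fun l => rfl, fun t => rfl⟩
  · simp only [matchingPoint, Sum.elim_inl, Sum.elim_inr]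
    by_cases h : ∀ t, (l, t) ∉ M
    · simp [h]
    · have h' := h
      push Not at h'
      obtain ⟨t, ht⟩ := h'
      rw [Set.indicator_of_notMem (by simpa using h), add_zero]
      exact sum_indicator_eq_one (S := {t | (l, t) ∈ M}) ht fun t' ht' => hM.1 l t' t ht' ht
  · simp only [matchingPoint, Sum.elim_inl, Sum.elim_inr]
    by_cases h : ∀ l, (l, t) ∉ M
    · simp [h]
    · have h' := h
      push Not at h'
      obtain ⟨l, hl⟩ := h'
      rw [Set.indicator_of_notMem (by simpa using h), add_zero]
      exact sum_indicator_eq_one (S := {l | (l, t) ∈ M}) hl fun l' hl' => hM.2 l' l t hl' hl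
  · by_cases h : a ∈ M <;> simp [matchingPoint, h]
  · rintro (a | (l | t) | (l | t)) <;>
      simp only [matchingPoint, Sum.elim_inl, Sum.elim_inr, Pi.zero_apply, le_refl] <;>
      exact Set.indicator_nonneg (fun _ _ => zero_le_one) _

theorem two_le_sum_indicator {ι : Type*} [Fintype ι] {S : Set ι} {i j : ι} (hi : i ∈ S)
    (hj : j ∈ S) (hij : i ≠ j) : 2 ≤ ∑ k, S.indicator (1 : ι → ℝ) k := by
  classical
  have h := Finset.sum_le_sum_of_subset_of_nonneg (Finset.subset_univ {i, j})
    (f := S.indicator (1 : ι → ℝ)) fun k _ _ => Set.indicator_nonneg (fun _ _ => zero_le_one) k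
  rw [Finset.sum_pair hij] at h
  simp only [Set.indicator_of_mem hi, Set.indicator_of_mem hj, Pi.one_apply] at h
  linarith

theorem one_le_sum_indicator {ι : Type*} [Fintype ι] {S : Set ι} {i : ι} (hi : i ∈ S) :
    1 ≤ ∑ k, S.indicator (1 : ι → ℝ) k := by
  have h := Finset.single_le_sum (f := S.indicator (1 : ι → ℝ))
    (fun k _ => Set.indicator_nonneg (fun _ _ => zero_le_one) k) (Finset.mem_univ i)
  simpa [hi] using h

/-- The points of the face whose arc part is an incidence vector belong to partial matchings. -/
theorem eq_matchingPoint_of_mem_face {M : Set (L × T)} {y : (L × T) ⊕ (L ⊕ T) ⊕ (L ⊕ T) → ℝ}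
    (hy : y ∈ (assignmentFace L T).toSet) (hx : ∀ a, y (.inl a) = M.indicator 1 a) :
    IsPartialMatching M ∧ y = matchingPoint M := by
  rw [mem_assignmentFace] at hy
  obtain ⟨hrow, hcol, -, hnn, hl0, ht0⟩ := hy
  simp only [hx] at hrow hcol
  have hrow' : ∀ l, ∑ t, Set.indicator {t | (l, t) ∈ M} (1 : T → ℝ) t +
    y (.inr (.inr (.inl l))) = 1 := hrow
  have hcol' : ∀ t, ∑ l, Set.indicator {l | (l, t) ∈ M} (1 : L → ℝ) l +
    y (.inr (.inl (.inr t))) = 1 := hcol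
  refine ⟨⟨fun l t t' ht ht' => ?_, fun l l' t hl hl' => ?_⟩, ?_⟩
  -- Two pairs in one row would force a row sum of at least 2, while the slack is nonnegative.
  · by_contra hne
    have := two_le_sum_indicator (S := {t | (l, t) ∈ M}) ht ht' hne
    linarith [hrow' l, hnn (.inr (.inr (.inl l)))]
  · by_contra hne
    have := two_le_sum_indicator (S := {l | (l, t) ∈ M}) hl hl' hne
    linarith [hcol' t, hnn (.inr (.inl (.inr t)))]
  · ext (a | (l | t) | (l | t))
    · exact hx a
    · exact hl0 l
    · simp only [matchingPoint, Sum.elim_inl, Sum.elim_inr]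
      by_cases h : ∀ l, (l, t) ∉ M
      · have h1 := hcol' t
        rw [Finset.sum_eq_zero fun l _ => Set.indicator_of_notMem (by exact h l) _] at h1
        rw [Set.indicator_of_mem (by exact h)]
        simpa using h1
      · rw [Set.indicator_of_notMem (by exact h)]
        push Not at h
        obtain ⟨l, hl⟩ := h
        have := one_le_sum_indicator (S := {l | (l, t) ∈ M}) hl
        exact le_antisymm (by linarith [hcol' t]) (hnn _)
    · simp only [matchingPoint, Sum.elim_inl, Sum.elim_inr]
      by_cases h : ∀ t, (l, t) ∉ M
      · have h1 := hrow' l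
        rw [Finset.sum_eq_zero fun t _ => Set.indicator_of_notMem (by exact h t) _] at h1
        rw [Set.indicator_of_mem (by exact h)]
        simpa using h1
      · rw [Set.indicator_of_notMem (by exact h)]
        push Not at h
        obtain ⟨t, ht⟩ := h
        have := one_le_sum_indicator (S := {t | (l, t) ∈ M}) ht
        exact le_antisymm (by linarith [hrow' l]) (hnn _)
    · exact ht0 t

theorem assignmentFace_isExposed :
    IsExposed ℝ (assignmentPoly L T).toSet (assignmentFace L T).toSet :=
  LinSystem.isExposed_restrictZero _ _ fun x hx k => by
    rw [assignmentPoly, Network.mem_pseudo] at hx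
    exact hx.2.2 _

theorem eq_zero_of_mem_openSegment {V : Type*} {x y z : V → ℝ} (h : z ∈ openSegment ℝ x y) {v : V}
    (hx : 0 ≤ x v) (hy : 0 ≤ y v) (hz : z v = 0) : x v = 0 := by
  obtain ⟨a, b, ha, hb, -, rfl⟩ := h
  simp only [Pi.add_apply, Pi.smul_apply, smul_eq_mul] at hz
  have h1 := mul_nonneg ha.le hx
  have h2 := mul_nonneg hb.le hy
  have h3 : a * x v = 0 := by linarith
  exact (mul_eq_zero.1 h3).resolve_left ha.ne'

omit [Fintype L] [Fintype T] [DecidableEq L] [DecidableEq T] in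
theorem isPartialMatching_empty : IsPartialMatching (∅ : Set (L × T)) := by
  simp [IsPartialMatching]

/-- All variables are nonnegative, so endpoints of a segment through this point vanish wherever it
does. They therefore lie in the face with zero arc part, and the remaining slacks are then forced.
-/
theorem matchingPoint_empty_mem_extremePoints :
    matchingPoint ∅ ∈ (assignmentPoly L T).toSet.extremePoints ℝ := by
  have hmem := matchingPoint_mem_face (L := L) (T := T) isPartialMatching_empty
  refine mem_extremePoints_iff_left.2 ⟨assignmentFace_subset hmem, fun x hx y hy hseg => ?_⟩
  have hx' := hx
  rw [assignmentPoly, Network.mem_pseudo] at hx hy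
  have hzero := fun v => eq_zero_of_mem_openSegment hseg (hx.2.2 v) (hy.2.2 v)
  refine (eq_matchingPoint_of_mem_face (M := ∅) ?_ fun a => ?_).2
  · refine (LinSystem.mem_restrictZero _ _ _).2 ⟨hx', ?_⟩
    rintro (l | t) <;> exact hzero _ rfl
  · rw [hzero _ (by simp [matchingPoint])]
    simp

omit [Fintype L] [Fintype T] in
-- Alternation prevents an arc from being used in both directions and keeps every entry in `{0, 1}`.
theorem flipStars_indicator {M : Set (L × T)} {p : List (Network.Dart (L × T))} (hnd : p.Nodup)
    (hfwd : ∀ a, (a, true) ∈ p → a ∉ M) (hbwd : ∀ a, (a, false) ∈ p → a ∈ M) (a : L × T) :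
    (flipStars M p).indicator (1 : L × T → ℝ) a = M.indicator 1 a + Network.pathVec p a := by
  rw [Network.pathVec_of_nodup hnd]
  by_cases h1 : (a, true) ∈ p
  · have h2 : (a, false) ∉ p := fun h => hfwd a h1 (hbwd a h)
    simp [flipStars, h1, h2, hfwd a h1]
  · by_cases h2 : (a, false) ∈ p
    · simp [flipStars, h1, h2, hbwd a h2]
    · by_cases h3 : a ∈ M <;> simp [flipStars, h1, h2, h3]

/-- `p` changes the partial matching `M` to `M'` along a path between unmatched nodes, which is a
maximal step of length one along a circuit. -/
def IsMatchingStep (M M' : Set (L × T)) (p : List (Network.Dart (L × T))) : Prop :=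
  ∃ (l : L) (t : T),
    (∀ t', (l, t') ∉ M) ∧ (∀ l', (l', t) ∉ M) ∧
    (assignmentNetwork L T).IsPath (Sum.inl l) (Sum.inr t) p ∧
    Network.pathCircuit (Sum.inl l) (Sum.inr t) p ∈ (assignmentFace L T).circuits ∧
    Network.pathCircuit (Sum.inl l) (Sum.inr t) p ∈ (assignmentPoly L T).circuits ∧
    (assignmentFace L T).IsMaximalStep (matchingPoint M)
      (Network.pathCircuit (Sum.inl l) (Sum.inr t) p) 1 ∧
    (assignmentPoly L T).IsMaximalStep (matchingPoint M)
      (Network.pathCircuit (Sum.inl l) (Sum.inr t) p) 1 ∧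
    matchingPoint M' =
      matchingPoint M + Network.pathCircuit (Sum.inl l) (Sum.inr t) p

/-- That the flipped set is a matching needs no combinatorial argument: the translated point lies in
the face and has 0/1 arc part. -/
theorem isMatchingStep_flipStars {M : Set (L × T)} (hM : IsPartialMatching M) {l : L} {t : T}
    (hl : ∀ t', (l, t') ∉ M) (ht : ∀ l', (l', t) ∉ M) {p : List (Network.Dart (L × T))}
    (hp : (assignmentNetwork L T).IsPath (Sum.inl l) (Sum.inr t) p)
    (hfwd : ∀ a, (a, true) ∈ p → a ∉ M) (hbwd : ∀ a, (a, false) ∈ p → a ∈ M) :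
    IsPartialMatching (flipStars M p) ∧ IsMatchingStep M (flipStars M p) p := by
  set g := Network.pathCircuit (Sum.inl l : L ⊕ T) (Sum.inr t) p with hg
  have hind := flipStars_indicator hp.nodup hfwd hbwd
  have hface0 := matchingPoint_mem_face hM
  have hzero : ∀ k : L ⊕ T, g (Sum.elim (fun l => Sum.inr (Sum.inl (Sum.inl l)))
      (fun t => Sum.inr (Sum.inr (Sum.inr t))) k) = 0 := by
    rintro (l' | t') <;> simp [hg, Network.pathCircuit]
  have hx : ∀ a, (matchingPoint M + g) (.inl a) = (flipStars M p).indicator 1 a := by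
    intro a; rw [hind]; rfl
  have hpoly : matchingPoint M + g ∈ (assignmentPoly L T).toSet := by
    have h0 := assignmentFace_subset hface0
    refine ⟨?_, ?_⟩
    · rw [Matrix.mulVec_add, h0.1]
      simp [assignmentPoly, hg, Network.pathCircuit_ker hp.1]
    · rw [assignmentPoly, Network.mem_pseudo] at h0
      refine ((Network.mem_pseudo (assignmentNetwork L T) (Sum.elim 1 (-1)) 1 _).2
        ⟨?_, ?_, ?_⟩).2
      · have := Network.pathCircuit_ker hp.1 (Sum.elim 1 (-1)) 1
        rw [Network.pseudo_mulVec] at this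
        intro i
        have h1 := congrFun this i
        have h2 := h0.1 i
        have h3 : (matchingPoint M + g) ∘ Sum.inl = matchingPoint M ∘ Sum.inl + g ∘ Sum.inl := rfl
        rw [h3, Matrix.mulVec_add, ← h2]
        simp only [Pi.add_apply, Pi.zero_apply, ← hg] at h1 ⊢
        linarith
      · intro a
        rw [hx]
        exact Set.indicator_le_self' (fun _ _ => zero_le_one) a
      · rintro (a | (l' | t') | (l' | t'))
        · rw [hx]
          exact Set.indicator_nonneg (fun _ _ => zero_le_one) a
        · simp [hg, matchingPoint, Network.pathCircuit]
        · by_cases h : t' = t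
          · subst h; simp [hg, matchingPoint, Network.pathCircuit, ht]
          · simpa [hg, Network.pathCircuit, h] using h0.2.2 (.inr (.inl (.inr t')))
        · by_cases h : l' = l
          · subst h; simp [hg, matchingPoint, Network.pathCircuit, hl]
          · simpa [hg, Network.pathCircuit, h] using h0.2.2 (.inr (.inr (.inl l')))
        · simp [hg, matchingPoint, Network.pathCircuit]
  have hface : matchingPoint M + g ∈ (assignmentFace L T).toSet :=
    (LinSystem.mem_restrictZero _ _ _).2 ⟨hpoly, fun k => by
      rw [Pi.add_apply, hzero, ((LinSystem.mem_restrictZero _ _ _).1 hface0).2, add_zero]⟩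
  have hcirc : g ∈ (assignmentPoly L T).circuits :=
    hp.pathCircuit_mem_circuits Sum.inl_ne_inr _ _
  have hstep : (assignmentPoly L T).IsMaximalStep (matchingPoint M) g 1 := by
    refine ⟨one_pos, by rwa [one_smul], fun β hβ hmem => ?_⟩
    rw [assignmentPoly, Network.mem_pseudo] at hmem
    -- The slack `s⁺` at the unmatched task `t` equals `1 - β` after a step of length `β`.
    have := hmem.2.2 (.inr (.inl (.inr t)))
    simp [hg, matchingPoint, Network.pathCircuit, ht] at this
    linarith
  obtain ⟨h1, h2⟩ := eq_matchingPoint_of_mem_face hface hx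
  exact ⟨h1, l, t, hl, ht, hp, LinSystem.circuits_restrictZero hcirc hzero, hcirc,
    hstep.restrictZero (by rw [one_smul]; exact hface), hstep, h2.symm⟩

end Matchings

/-! ### Ranked primes, maximal alternating paths and the invariant of a run. -/

section Hungarian

variable {L T : Type*}

/-- The primed zeros `Q` can be ranked by rows, with regard to the starred zeros `S`: the row of the
starred zero in the column of a primed zero contains a primed zero and has a smaller rank. -/
def PrimesRanked (S Q : Set (L × T)) (τ : L → ℕ) : Prop :=
  ∀ l t l', (l, t) ∈ Q → (l', t) ∈ S → (∃ t', (l', t') ∈ Q) ∧ τ l' < τ l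

theorem PrimesRanked.disjoint {S Q : Set (L × T)} {τ : L → ℕ} (h : PrimesRanked S Q τ)
    {a : L × T} (ha : a ∈ Q) : a ∉ S :=
  fun hS => lt_irrefl _ (h a.1 a.2 a.1 ha hS).2

/-- Ranks decrease along the alternating walks to the column of a starred zero `(l', t')`. -/
theorem PrimesRanked.rank_walk {S Q : Set (L × T)} {τ : L → ℕ} (h : PrimesRanked S Q τ)
    {l' : L} {t' : T} (hS : (l', t') ∈ S) {i : L ⊕ T} {p : List (Network.Dart (L × T))}
    (hp : (assignmentNetwork L T).IsWalk i (.inr t') p)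
    (hfwd : ∀ a, (a, true) ∈ p → a ∈ Q) (hbwd : ∀ a, (a, false) ∈ p → a ∈ S) :
    (∀ l, i = .inl l → τ l' < τ l) ∧ ∀ t, i = .inr t → ∃ l, (l, t) ∈ S ∧ τ l' ≤ τ l := by
  induction p generalizing i with
  | nil =>
    obtain rfl := Network.isWalk_nil_iff.1 hp
    refine ⟨by simp, fun t ht => ?_⟩
    obtain rfl := Sum.inr_injective ht
    exact ⟨l', hS, le_rfl⟩
  | cons e p ih =>
    obtain ⟨rfl, hw⟩ := Network.isWalk_cons_iff.1 hp
    obtain ⟨ih1, ih2⟩ := ih hw (fun a ha => hfwd a (List.mem_cons_of_mem _ ha))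
      fun a ha => hbwd a (List.mem_cons_of_mem _ ha)
    obtain ⟨⟨l, t⟩, s⟩ := e
    cases s
    · refine ⟨by simp [Network.first, assignmentNetwork], fun t₁ ht => ?_⟩
      obtain rfl : t = t₁ := Sum.inr_injective ht
      exact ⟨l, hbwd _ List.mem_cons_self, (ih1 l rfl).le⟩
    · refine ⟨fun l₁ hl => ?_, by simp [Network.first, assignmentNetwork]⟩
      obtain rfl : l = l₁ := Sum.inl_injective hl
      obtain ⟨l₂, hl₂, hle⟩ := ih2 t rfl
      exact hle.trans_lt (h l t l₂ (hfwd _ List.mem_cons_self) hl₂).2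

/-- An inclusion-maximal alternating path ends in a column without starred zeros. -/
theorem PrimesRanked.exists_of_isMaxAlternating {S Q : Set (L × T)} {τ : L → ℕ}
    (h : PrimesRanked S Q τ) {l : L} {t : T} {p : List (Network.Dart (L × T))}
    (hp : IsMaxAlternating S Q l t p) :
    ∃ t', (∀ l', (l', t') ∉ S) ∧ (assignmentNetwork L T).IsPath (.inl l) (.inr t') p := by
  obtain ⟨⟨⟨t', hpath⟩, hhead, hfwd, hbwd⟩, hmax⟩ := hp
  refine ⟨t', fun l' hS => ?_, hpath⟩
  obtain ⟨a, ha, rfl⟩ : ∃ a, (a, true) ∈ p ∧ a.2 = t' := by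
    have := hpath.1.last_mem
    rw [List.mem_cons, or_iff_right Sum.inr_ne_inl, List.mem_map] at this
    obtain ⟨⟨a, s⟩, he, hlast⟩ := this
    cases s
    · simp [Network.last, assignmentNetwork] at hlast
    · exact ⟨a, he, Sum.inr_injective hlast⟩
  obtain ⟨⟨t'', hQ⟩, -⟩ := h a.1 a.2 l' (hfwd a ha) hS
  have hsuffix : ∀ v ∈ (Sum.inl l : L ⊕ T) :: p.map (assignmentNetwork L T).last,
      (∀ l₁, v = .inl l₁ → τ l' < τ l₁) ∧ ∀ t₁, v = .inr t₁ → ∃ l, (l, t₁) ∈ S ∧ τ l' ≤ τ l := by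
    intro v hv
    obtain ⟨q, hq, hw⟩ := hpath.1.exists_suffix hv
    exact h.rank_walk hS hw (fun a ha => hfwd a (hq ha)) fun a ha => hbwd a (hq ha)
  -- Every row on the path has rank above that of `l'`. If the column `t''` were on it, it would
  -- hold a star of rank at least that of `l'`, but the prime at `(l', t'')` demands a smaller one.
  have hl' : (Sum.inl l' : L ⊕ T) ∉ Sum.inl l :: p.map (assignmentNetwork L T).last :=
    fun hv => lt_irrefl _ ((hsuffix _ hv).1 l' rfl)
  have ht'' : (Sum.inr t'' : L ⊕ T) ∉ Sum.inl l :: p.map (assignmentNetwork L T).last := by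
    intro hv
    obtain ⟨l₁, hl₁, hle⟩ := (hsuffix _ hv).2 t'' rfl
    exact (h l' t'' l₁ hQ hl₁).2.not_ge hle
  have hnew : IsAlternating S Q l t (p ++ [((l', a.2), false), ((l', t''), true)]) := by
    refine ⟨⟨t'', hpath.1.append ?_, ?_⟩, ?_, ?_, ?_⟩
    · exact Network.isWalk_cons_iff.2
        ⟨rfl, Network.isWalk_cons_iff.2 ⟨rfl, Network.isWalk_nil_iff.2 rfl⟩⟩
    · rw [List.map_append, ← List.cons_append, List.nodup_append']
      refine ⟨hpath.2, by simp [Network.last, assignmentNetwork], ?_⟩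
      intro v hv hv'
      simp only [Network.last, assignmentNetwork, List.map_cons, List.map_nil, List.mem_cons,
        List.not_mem_nil, or_false, if_true, Bool.false_eq_true, if_false] at hv'
      rcases hv' with rfl | rfl
      exacts [hl' hv, ht'' hv]
    · rw [List.head?_append, hhead, Option.some_or]
    · intro b hb
      simp only [List.mem_append, List.mem_cons, Prod.mk.injEq, List.not_mem_nil, or_false] at hb
      rcases hb with hb | ⟨-, hb⟩ | ⟨rfl, -⟩
      exacts [hfwd b hb, absurd hb (by simp), hQ]
    · intro b hb
      simp only [List.mem_append, List.mem_cons, Prod.mk.injEq, List.not_mem_nil, or_false] at hb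
      rcases hb with hb | ⟨rfl, -⟩ | ⟨-, hb⟩
      exacts [hbwd b hb, hS, absurd hb (by simp)]
  -- Maximality puts the added star on `p`, so `p` would already visit `l'`.
  have hmem : ((l', a.2), false) ∈ p := hmax _ hnew (List.subset_append_left _ _) (by simp)
  exact hl' (List.mem_cons_of_mem _ (List.mem_map.2 ⟨_, hmem, rfl⟩))

/-- The invariant of the Hungarian Method. -/
structure HMState.Invariant (σ : HMState L T) : Prop where
  matching : IsPartialMatching σ.star
  ranked : ∃ τ, PrimesRanked σ.star σ.prime τ
  prime_covered : ∀ l t, (l, t) ∈ σ.prime → l ∈ σ.rowCov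
  prime_greedy : σ.phase = HMPhase.greedy → σ.prime = ∅
  prime_of_uncovered : σ.phase ≠ HMPhase.greedy → ∀ l t, (l, t) ∈ σ.star → t ∉ σ.colCov →
    ∃ t', (l, t') ∈ σ.prime

theorem HMState.invariant_init (C : L → T → ℝ) : (HMState.init C).Invariant where
  matching := by simp [HMState.init, IsPartialMatching]
  ranked := ⟨0, by simp [HMState.init, PrimesRanked]⟩
  prime_covered := by simp [HMState.init]
  prime_greedy _ := rfl
  prime_of_uncovered h := absurd rfl h

/-- If an uncovered zero is primed, then its row can be given the largest rank. -/
theorem HMState.Invariant.exists_ranked_insert [Fintype L] [DecidableEq L] {σ : HMState L T}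
    (h : σ.Invariant) (hphase : σ.phase ≠ HMPhase.greedy) {l : L} {t : T}
    (hunc : σ.Uncovered l t) : ∃ τ, PrimesRanked σ.star (insert (l, t) σ.prime) τ := by
  obtain ⟨τ, hτ⟩ := h.ranked
  -- Primed rows are covered and `l` is not, so re-ranking `l` leaves the ranks of all primed rows
  -- unchanged.
  have hne : ∀ l' t', (l', t') ∈ σ.prime → l' ≠ l := by
    rintro l' t' h' rfl
    exact hunc.1 (h.prime_covered _ _ h')
  refine ⟨Function.update τ l (Finset.univ.sup τ + 1), fun l₁ t₁ l' h₁ hS => ?_⟩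
  rcases h₁ with h₁ | h₁
  · obtain ⟨rfl, rfl⟩ := Prod.mk.inj h₁
    -- A starred column is uncovered only after its star's row has received a prime.
    obtain ⟨t', ht'⟩ := h.prime_of_uncovered hphase l' t₁ hS hunc.2
    refine ⟨⟨t', Or.inr ht'⟩, ?_⟩
    rw [Function.update_self, Function.update_of_ne (hne _ _ ht')]
    exact Nat.lt_succ_of_le (Finset.le_sup (Finset.mem_univ l'))
  · obtain ⟨⟨t', ht'⟩, hlt⟩ := hτ l₁ t₁ l' h₁ hS
    refine ⟨⟨t', Or.inr ht'⟩, ?_⟩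
    rwa [Function.update_of_ne (hne _ _ ht'), Function.update_of_ne (hne _ _ h₁)]

variable [Fintype L] [Fintype T] [DecidableEq L] [DecidableEq T]

theorem HMStep.isMatchingStep {σ σ' : HMState L T} {p : List (Network.Dart (L × T))}
    (h : σ.Invariant) (hstep : HMStep σ (some p) σ') :
    IsPartialMatching σ'.star ∧ IsMatchingStep σ.star σ'.star p := by
  cases hstep with
  | assign l t hphase hzero hrow hcol =>
    have heq : insert (l, t) σ.star = flipStars σ.star [((l, t), true)] := by
      ext a; simp [flipStars, or_comm]
    simp only [HMState.RowStarred, HMState.ColStarred, not_exists] at hrow hcol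
    simp only [heq]
    refine isMatchingStep_flipStars h.matching hrow hcol ⟨?_, ?_⟩ ?_ (by simp)
    · exact Network.isWalk_cons_iff.2 ⟨rfl, Network.isWalk_nil_iff.2 rfl⟩
    · simp [Network.last, assignmentNetwork]
    · rintro a ha
      obtain rfl : a = (l, t) := by simpa using ha
      exact hrow t
  | augment l t _ hphase hzero hrow hp =>
    obtain ⟨τ, hτ⟩ := h.exists_ranked_insert (by simp [hphase]) hzero.1
    obtain ⟨t', ht', hpath⟩ := hτ.exists_of_isMaxAlternating hp
    exact isMatchingStep_flipStars h.matching (fun t₁ h₁ => hrow ⟨t₁, h₁⟩) ht' hpath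
      (fun a ha => hτ.disjoint (hp.1.2.2.1 a ha)) hp.1.2.2.2

theorem HMStep.invariant {σ σ' : HMState L T} {o : Option (List (Network.Dart (L × T)))}
    (h : σ.Invariant) (hstep : HMStep σ o σ') : σ'.Invariant := by
  have hstep' := hstep
  cases hstep with
  | assign l t hphase hzero hrow hcol =>
    have hprime := h.prime_greedy hphase
    exact ⟨(hstep'.isMatchingStep h).1, ⟨0, by simp [hprime, PrimesRanked]⟩, h.prime_covered,
      h.prime_greedy, fun hne => absurd hphase hne⟩
  | cover hphase hmax =>
    exact ⟨h.matching, h.ranked, h.prime_covered, fun _ => h.prime_greedy hphase,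
      fun _ l t hs hc => absurd ⟨l, hs⟩ hc⟩
  | enter hphase _ =>
    exact ⟨h.matching, h.ranked, h.prime_covered, nofun,
      fun _ => h.prime_of_uncovered (by simp [hphase])⟩
  | exit hphase _ =>
    exact ⟨h.matching, h.ranked, h.prime_covered, nofun,
      fun _ => h.prime_of_uncovered (by simp [hphase])⟩
  | prime l t ts hphase hzero hstar =>
    refine ⟨h.matching, h.exists_ranked_insert (by simp [hphase]) hzero.1, ?_,
      fun hg => by simp [hphase] at hg, fun _ l' t' hs hc => ?_⟩
    · rintro l' t' (h' | h')
      · exact Or.inl (Prod.mk.inj h').1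
      · exact Or.inr (h.prime_covered _ _ h')
    · by_cases ht : t' = ts
      · subst ht
        -- The only star in the newly uncovered column lies in row `l`, which has just been primed.
        exact ⟨t, Or.inl (by rw [h.matching.2 _ _ _ hs hstar])⟩
      · obtain ⟨t₁, ht₁⟩ := h.prime_of_uncovered (by simp [hphase]) l' t' hs
          fun hmem => hc ⟨hmem, ht⟩
        exact ⟨t₁, Or.inr ht₁⟩
  | augment l t p hphase hzero hrow hp =>
    exact ⟨(hstep'.isMatchingStep h).1, ⟨0, nofun⟩, nofun, fun _ => rfl,
      fun _ l' t' hs hc => absurd ⟨l', hs⟩ hc⟩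
  | adjust l t hphase _ _ _ =>
    exact ⟨h.matching, h.ranked, h.prime_covered, nofun,
      fun _ => h.prime_of_uncovered (by simp [hphase])⟩

omit [Fintype L] [Fintype T] [DecidableEq L] [DecidableEq T] in
theorem HMStep.star_eq {σ σ' : HMState L T} (hstep : HMStep σ none σ') : σ'.star = σ.star := by
  cases hstep <;> rfl

theorem HungarianRun.invariant {C : L → T → ℝ} {σ : HMState L T} {Ms : List (Set (L × T))}
    (hrun : HungarianRun C σ Ms) : σ.Invariant := by
  induction hrun with
  | start => exact HMState.invariant_init C
  | silent _ hstep ih => exact hstep.invariant ih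
  | update _ hstep ih => exact hstep.invariant ih

/-- Knowing the last entry is what lets the induction link a newly constructed matching to the
chain. -/
theorem HungarianRun.matchings {C : L → T → ℝ} {σ : HMState L T} {Ms : List (Set (L × T))}
    (hrun : HungarianRun C σ Ms) :
    Ms.head? = some ∅ ∧ Ms.getLast? = some σ.star ∧ (∀ M ∈ Ms, IsPartialMatching M) ∧
      Ms.IsChain fun M M' => ∃ p, IsMatchingStep M M' p := by
  induction hrun with
  | start => simp [HMState.init, isPartialMatching_empty]
  | silent _ hstep ih => rwa [hstep.star_eq]
  | @update σ σ' Ms p hrun hstep ih =>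
    obtain ⟨hhead, hlast, hall, hchain⟩ := ih
    obtain ⟨hM, hMstep⟩ := hstep.isMatchingStep hrun.invariant
    refine ⟨by rw [List.head?_append, hhead, Option.some_or], by simp, ?_, ?_⟩
    · intro M h
      rcases List.mem_append.1 h with h | h
      · exact hall M h
      · rw [List.mem_singleton.1 h]; exact hM
    · refine List.isChain_append.2 ⟨hchain, by simp, ?_⟩
      rw [hlast]
      rintro _ ⟨⟩ _ ⟨⟩
      exact ⟨p, hMstep⟩

end Hungarian

theorem lemma4 {L T : Type*} [Fintype L] [Fintype T] [DecidableEq L] [DecidableEq T]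
    (hsquare : Fintype.card L = Fintype.card T) (C : L → T → ℝ)
    (σ : HMState L T) (Ms : List (Set (L × T))) (hrun : HungarianRun C σ Ms) :
    -- `F` is a face of the pseudoflow polyhedron
    IsExposed ℝ (assignmentPoly L T).toSet (assignmentFace L T).toSet ∧
    -- the run is a circuit walk over `F`, and also one of the whole pseudoflow polyhedron
    (assignmentFace L T).IsCircuitWalk (Ms.map matchingPoint) ∧
    (assignmentPoly L T).IsCircuitWalk (Ms.map matchingPoint) ∧
    -- each assignment or augmentation that the method can make after this run is a maximal step
    -- of length one along the circuit `(H, -e_t, -e_l)` of its path from `l` to `t`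
    ∀ (p : List (Network.Dart (L × T))) (σ' : HMState L T), HMStep σ (some p) σ' →
      ∃ (l : L) (t : T),
        (∀ t', (l, t') ∉ σ.star) ∧ (∀ l', (l', t) ∉ σ.star) ∧
        (assignmentNetwork L T).IsPath (Sum.inl l) (Sum.inr t) p ∧
        Network.pathCircuit (Sum.inl l) (Sum.inr t) p ∈ (assignmentFace L T).circuits ∧
        Network.pathCircuit (Sum.inl l) (Sum.inr t) p ∈ (assignmentPoly L T).circuits ∧
        (assignmentFace L T).IsMaximalStep (matchingPoint σ.star)
          (Network.pathCircuit (Sum.inl l) (Sum.inr t) p) 1 ∧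
        (assignmentPoly L T).IsMaximalStep (matchingPoint σ.star)
          (Network.pathCircuit (Sum.inl l) (Sum.inr t) p) 1 ∧
        matchingPoint σ'.star =
          matchingPoint σ.star + Network.pathCircuit (Sum.inl l) (Sum.inr t) p := by
  obtain ⟨hhead, -, hall, hchain⟩ := hrun.matchings
  have hvertex := matchingPoint_empty_mem_extremePoints (L := L) (T := T)
  have hempty := matchingPoint_mem_face (L := L) (T := T) isPartialMatching_empty
  have hmem : ∀ x ∈ Ms.map matchingPoint, x ∈ (assignmentFace L T).toSet := by
    intro x hx
    obtain ⟨M, hM, rfl⟩ := List.mem_map.1 hx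
    exact matchingPoint_mem_face (hall M hM)
  have hhead' : matchingPoint ∅ ∈ (Ms.map matchingPoint).head? := by
    rw [List.head?_map, hhead]; rfl
  refine ⟨assignmentFace_isExposed, ⟨⟨_, hhead', ?_⟩, hmem, ?_⟩,
    ⟨⟨_, hhead', hvertex⟩, fun x hx => assignmentFace_subset (hmem x hx), ?_⟩,
    fun p σ' hstep => (hstep.isMatchingStep hrun.invariant).2⟩
  -- A vertex of the whole polyhedron that lies in the face is a vertex of the face.
  · exact inter_extremePoints_subset_extremePoints_of_subset assignmentFace_subset
      ⟨hempty, hvertex⟩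
  · rw [List.isChain_map]
    refine hchain.imp ?_
    rintro M M' ⟨p, l, t, -, -, -, hc, -, hm, -, heq⟩
    exact ⟨_, hc, 1, hm, by rw [heq, one_smul]⟩
  · rw [List.isChain_map]
    refine hchain.imp ?_
    rintro M M' ⟨p, l, t, -, -, -, -, hc, -, hm, heq⟩
    exact ⟨_, hc, 1, hm, by rw [heq, one_smul]⟩
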